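/- For real numbers $\theta,\phi$ put \[ L(\theta,\phi)=\liminf_{|q|\to\infty}\,|q|\,\|q\theta-\phi\| \qquad (q\in\mathbb Z), \] where $\|x\|$ denotes the distance from $x$ to the nearest integer. **Theorem 7 (generalization of Komatsu's conjecture).** Let $\theta$ be an irrational number whose regular simple continued fraction has the form \[ \theta=[a_0;\,c_1,\ldots,c_{n_1},\,a_1,\,c_{n_1+1},\ldots,c_{n_1+n_2},\,a_2,\ldots], \] where $n_i\ge 0$ for all $i\ge1$, $\lim_{i\to\infty}a_i=\infty$, and either $\{c_i\}$ is a finite sequence or $\limsup_{i\to\infty}c_i=1$. Let $n\ge 2$ be an integer such that the sequence of partial quotients of $\theta$ (including the initial term $a_0$) is completely periodic modulo $n$, that is, purely periodic modulo $n$ with no pre-period. If $n_i\in\{0,2\}$ for every $i\ge 1$, then \[ n^2L(\theta,\phi)\in\{0,\tfrac12\}\qquad\text{for both } \phi=\tfrac1n \text{ and } \phi=-\tfrac{\theta}{n}. \] In particular, for every integer $k\ge 2$ and every integer $n\ge 2$, \[ n^2L(e^{2/k},\phi)\in\{0,\tfrac12\}\qquad\text{for both } \phi=\tfrac1n \text{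 and } \phi=-\tfrac{e^{2/k}}{n}. \] -/

import Mathlib

open Filter
open scoped ENNReal

/-- The distance `‖x‖` from the real number `x` to the nearest integer. -/
noncomputable def distNearestInt (x : ℝ) : ℝ := |x - round x|

/-- The inhomogeneous approximation constant
`L(θ, φ) = liminf_{|q| → ∞} |q| ‖q θ - φ‖`, where `q` runs through all (positive and negative)
integers. It takes values in `[0, ∞]`, so that the lower limit always exists. -/
noncomputable def inhomApproxConst (θ φ : ℝ) : ℝ≥0∞ :=
  liminf (fun q : ℤ => ENNReal.ofReal (|(q : ℝ)| * distNearestInt (q * θ - φ)))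
    (comap (fun q : ℤ => |q|) atTop)

/-- `θ = [b 0; b 1, b 2, …]` is the (infinite) regular simple continued fraction of `θ`. -/
def HasPartialQuotients (θ : ℝ) (b : ℕ → ℤ) : Prop :=
  (GenContFract.of θ).h = (b 0 : ℝ) ∧
    ∀ i : ℕ, (GenContFract.of θ).partDens.get? i = some (b (i + 1) : ℝ)

/-- The sequence `b 0, b 1, …` is completely (that is, purely) periodic modulo `n`. -/
def CompletelyPeriodicMod (n : ℕ) (b : ℕ → ℤ) : Prop :=
  ∃ T : ℕ, 0 < T ∧ ∀ i : ℕ, b (i + T) ≡ b i [ZMOD (n : ℤ)]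

/-- `n_1 + ⋯ + n_j`, for block lengths `n_1, n_2, …` (the value `len 0` is not used). -/
def blockSum (len : ℕ → ℕ) (j : ℕ) : ℕ := ∑ i ∈ Finset.range j, len (i + 1)

/-- The sequence `b` is
`a_0; c_1, …, c_{n_1}, a_1, c_{n_1+1}, …, c_{n_1+n_2}, a_2, …` with `n_i = len i` for `i ≥ 1`,
where `a_i → ∞`, and either `c_1, c_2, …` is a finite sequence or `limsup c_i = 1`.
The values `c 0` and, in the finite case, `c i` beyond the length `∑ n_i` of the sequence are
not used. -/
structure HasBlockForm (b a c : ℕ → ℤ) (len : ℕ → ℕ) : Prop where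
  /-- `a_j` is preceded by `a_0, …, a_{j-1}` and by `c_1, …, c_{n_1+⋯+n_j}`. -/
  large : ∀ j : ℕ, b (blockSum len j + j) = a j
  /-- The block between `a_j` and `a_{j+1}`. -/
  small : ∀ j t : ℕ, 1 ≤ t → t ≤ len (j + 1) →
    b (blockSum len j + j + t) = c (blockSum len j + t)
  tendsto_large : Tendsto a atTop atTop
  small_finite_or_limsup :
    (∃ K : ℕ, ∀ j : ℕ, blockSum len j ≤ K) ∨ limsup c atTop = 1

/-!
Put `w(P, Q) = |Q| |Q θ - P|`. For `φ = (u - v θ) / n` the substitution `Q = n q + v`,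
`P = n p + u` turns `n² L(θ, φ)` into the lower limit of `w(P, Q)` over the pairs
`(P, Q) ≡ (u, v)` modulo `n`; here `(u, v)` is `(1, 0)` for `φ = 1 / n` and `(0, 1)` for
`φ = -θ / n` (`sq_mul_inhomApproxConst_le`, `le_sq_mul_inhomApproxConst`).

By Legendre's criterion (`legendre`), a pair with `w < 1 / 2` is a multiple of a convergent
`(p_i, q_i)`. When the partial quotients tend to infinity apart from isolated pairs `1, 1`, the
numbers `w(p_i, q_i)` accumulate only at `0` and `1 / 2` (`eventually_convDen_mul_abs_convErr`).
Since the partial quotients are purely periodic modulo `n`, the class `(u, v)` contains infinitely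
many convergents (`exists_conv_modEq`), so that the lower limit is at most `1 / 2`. Suppose it is
positive and let `(P, Q) = d (p_i, q_i)` be in the class with `w(P, Q) < 1 / 2`. Replacing `d` by
its residue modulo `n` does not change the class, and gives a lower bound for `w(p_i, q_i)` that
does not depend on `i`; hence `w(p_i, q_i)` is close to `1 / 2`, and so is
`w(P, Q) = d² w(p_i, q_i)`. This is `sq_mul_inhomApproxConst_eq_zero_or_half`.

The argument uses the partial quotients only through the recurrence of the convergents and through
the alternating signs of the remainders `q_i θ - p_i`, so it also covers formal continued fractions
with a zero among the partial quotients. This matters for `e`, where the purely periodic sequence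
modulo `n` is `1, 0, 1, 1, 2, 1, 1, 4, 1, …` rather than the regular one. For `e^{2/k}` the
remainders are combinations of the positive integrals
`R_j = c^{j+1} / j! ∫₀¹ (t (1 - t))^j e^{c t} dt`, `c = 2 / k`, which satisfy
`R_j = (2 j + 3) k R_{j+1} + R_{j+2}` (`padeRem_rec`); this makes their signs explicit
(`expQuotEven_alternating`, `expQuotOdd_alternating`).
-/

/-! ### Formal convergents -/

/-- The sequence with `s 0 = x`, `s 1 = y` and `s (i + 2) = b i * s (i + 1) + s i`. -/
def convSeq {R : Type*} [CommRing R] (b : ℕ → ℤ) (x y : R) : ℕ → R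
  | 0 => x
  | 1 => y
  | i + 2 => b i * convSeq b x y (i + 1) + convSeq b x y i

/-- The numerators of the convergents of `[b 0; b 1, …]`, shifted by two: `convNum b (i + 2)` is
the classical `p_i`, and the sequence starts with `p_{-2} = 0`, `p_{-1} = 1`. -/
def convNum (b : ℕ → ℤ) : ℕ → ℤ := convSeq b 0 1

/-- The denominators of the convergents of `[b 0; b 1, …]`, shifted by two: `convDen b (i + 2)` is
the classical `q_i`, and the sequence starts with `q_{-2} = 1`, `q_{-1} = 0`. -/
def convDen (b : ℕ → ℤ) : ℕ → ℤ := convSeq b 1 0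

/-- The remainders `q_i θ - p_i` of the convergents, with the index shifted by two. -/
def convErr (b : ℕ → ℤ) (θ : ℝ) : ℕ → ℝ := convSeq b θ (-1)

section Recurrence

variable (b : ℕ → ℤ) (θ : ℝ) (i : ℕ)

theorem convNum_add_two : convNum b (i + 2) = b i * convNum b (i + 1) + convNum b i := by
  simp [convNum, convSeq]

theorem convDen_add_two : convDen b (i + 2) = b i * convDen b (i + 1) + convDen b i := by
  simp [convDen, convSeq]

theorem convErr_add_two : convErr b θ (i + 2) = b i * convErr b θ (i + 1) + convErr b θ i := by
  simp [convErr, convSeq]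

theorem convErr_eq : convErr b θ i = convDen b i * θ - convNum b i := by
  induction i using Nat.twoStepInduction with
  | zero => simp [convErr, convDen, convNum, convSeq]
  | one => simp [convErr, convDen, convNum, convSeq]
  | more i h0 h1 =>
    rw [convErr_add_two, convDen_add_two, convNum_add_two, h0, h1]
    push_cast
    ring

theorem convNum_mul_convDen_sub :
    convNum b (i + 1) * convDen b i - convNum b i * convDen b (i + 1) = (-1) ^ i := by
  induction i with
  | zero => simp [convDen, convNum, convSeq]
  | succ i ih =>
    rw [convDen_add_two, convNum_add_two, pow_succ, ← ih]
    ring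

end Recurrence

/-- Purely periodic partial quotients modulo `n` make the convergents purely periodic modulo `n`:
the initial pair of columns `(0, 1)`, `(1, 0)` recurs at arbitrarily large indices. -/
theorem exists_conv_modEq {b : ℕ → ℤ} {n : ℕ} (hn : 2 ≤ n) (hb : CompletelyPeriodicMod n b)
    (N : ℕ) : ∃ i, N ≤ i ∧
      ((convNum b i ≡ 0 [ZMOD n] ∧ convDen b i ≡ 1 [ZMOD n]) ∧
        (convNum b (i + 1) ≡ 1 [ZMOD n] ∧ convDen b (i + 1) ≡ 0 [ZMOD n])) := by
  obtain ⟨T, hT, hper⟩ := hb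
  have : NeZero n := ⟨by omega⟩
  have hper' : ∀ m i : ℕ, ((b (i + m * T) : ℤ) : ZMod n) = b i := by
    intro m
    induction m with
    | zero => simp
    | succ m ih =>
      intro i
      rw [← ih i, show i + (m + 1) * T = i + m * T + T by ring]
      exact (ZMod.intCast_eq_intCast_iff _ _ _).2 (hper _)
  let P : ℕ → ZMod n := fun i => convNum b i
  let Q : ℕ → ZMod n := fun i => convDen b i
  have hP : ∀ i, P i = P (i + 2) - b i * P (i + 1) := by
    intro i; simp only [P, convNum_add_two]; push_cast; ring
  have hQ : ∀ i, Q i = Q (i + 2) - b i * Q (i + 1) := by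
    intro i; simp only [Q, convDen_add_two]; push_cast; ring
  -- Two of the states at the multiples of the period `(N + 1) * T` agree.
  obtain ⟨m, m', hlt, heq⟩ : ∃ m m' : ℕ, m < m' ∧
      (P (m * ((N + 1) * T)), P (m * ((N + 1) * T) + 1),
        Q (m * ((N + 1) * T)), Q (m * ((N + 1) * T) + 1)) =
      (P (m' * ((N + 1) * T)), P (m' * ((N + 1) * T) + 1),
        Q (m' * ((N + 1) * T)), Q (m' * ((N + 1) * T) + 1)) := by
    obtain ⟨m, m', hne, h⟩ := Finite.exists_ne_map_eq_of_infinite (fun m : ℕ =>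
      (P (m * ((N + 1) * T)), P (m * ((N + 1) * T) + 1),
        Q (m * ((N + 1) * T)), Q (m * ((N + 1) * T) + 1)))
    rcases lt_or_gt_of_ne hne with h' | h'
    · exact ⟨m, m', h', h⟩
    · exact ⟨m', m, h', h.symm⟩
  obtain ⟨e, rfl⟩ := Nat.exists_eq_add_of_lt hlt
  set S := (e + 1) * (N + 1) * T with hS
  have hSle : N ≤ S := by
    have : (N + 1) * 1 ≤ (N + 1) * T := Nat.mul_le_mul_left _ hT
    have h2 : 1 * ((N + 1) * T) ≤ (e + 1) * ((N + 1) * T) := Nat.mul_le_mul_right _ (by omega)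
    rw [hS, mul_assoc]
    omega
  -- The recurrence can be run backwards, down to index zero.
  have hback : ∀ i, (P i = P (i + S) ∧ P (i + 1) = P (i + S + 1) ∧
      Q i = Q (i + S) ∧ Q (i + 1) = Q (i + S + 1)) →
      (P 0 = P S ∧ P 1 = P (S + 1) ∧ Q 0 = Q S ∧ Q 1 = Q (S + 1)) := by
    intro i
    induction i with
    | zero => simp
    | succ i ih =>
      rintro ⟨h1, h2, h3, h4⟩
      have hbi : ((b (i + S) : ℤ) : ZMod n) = b i := hper' _ _
      have e1 : i + 1 + S = i + S + 1 := by ring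
      have e2 : i + 1 + S + 1 = i + S + 2 := by ring
      rw [e1] at h1 h3
      rw [e2] at h2 h4
      refine ih ⟨?_, h1, ?_, h3⟩
      · rw [hP i, hP (i + S), hbi, ← h1, ← h2]
      · rw [hQ i, hQ (i + S), hbi, ← h3, ← h4]
  simp only [Prod.mk.injEq] at heq
  have e3 : (m + e + 1) * ((N + 1) * T) = m * ((N + 1) * T) + S := by rw [hS]; ring
  rw [e3] at heq
  obtain ⟨h1, h2, h3, h4⟩ := hback _ heq
  have z : P 0 = 0 ∧ P 1 = 1 ∧ Q 0 = 1 ∧ Q 1 = 0 := by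
    simp [P, Q, convNum, convDen, convSeq]
  refine ⟨S, hSle, ⟨?_, ?_⟩, ?_, ?_⟩ <;> rw [← ZMod.intCast_eq_intCast_iff]
  · simpa [z.1] using h1.symm
  · simpa [z.2.2.1] using h3.symm
  · simpa [z.2.1] using h2.symm
  · simpa [z.2.2.2] using h4.symm

/-- Every partial quotient from some point on is either large or belongs to a pair `1, 1` of
partial quotients with large ones on both sides. -/
def LargeOrPairOfOnes (b : ℕ → ℤ) : Prop :=
  ∀ A : ℤ, ∀ᶠ i in atTop, A ≤ b (i + 2) ∨
    (b (i + 2) = 1 ∧ b (i + 3) = 1 ∧ A ≤ b (i + 1) ∧ A ≤ b (i + 4)) ∨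
    (b (i + 1) = 1 ∧ b (i + 2) = 1 ∧ A ≤ b i ∧ A ≤ b (i + 3))

/-! ### Legendre's criterion and the size of the remainders -/

section Convergents

variable {b : ℕ → ℤ} {θ : ℝ}

theorem convDen_nonneg (hb : ∀ i, 1 ≤ i → 0 ≤ b i) (i : ℕ) : 0 ≤ convDen b i := by
  have h : ∀ i, 0 ≤ convDen b (i + 1) := by
    intro i
    induction i using Nat.twoStepInduction with
    | zero => simp [convDen, convSeq]
    | one => simp [convDen, convSeq]
    | more i h0 h1 =>
      rw [convDen_add_two]
      exact add_nonneg (mul_nonneg (hb _ (by omega)) h1) h0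
  cases i with
  | zero => simp [convDen, convSeq]
  | succ i => exact h i

theorem eventually_one_le_of_largeOrPairOfOnes (hb : LargeOrPairOfOnes b) :
    ∀ᶠ i in atTop, 1 ≤ b i := by
  have h : ∀ᶠ i in atTop, 1 ≤ b (i + 2) := by
    filter_upwards [hb 1] with i hi
    omega
  rwa [← map_add_atTop_eq_nat 2, eventually_map]

/-- From some index on, the convergents have the usual properties: positive partial quotients,
positive denominators, increasing denominators and remainders of alternating sign. -/
theorem exists_regular (hb : ∀ i, 1 ≤ i → 0 ≤ b i) (hpat : LargeOrPairOfOnes b)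
    (hD : ∀ᶠ i in atTop, convErr b θ i * convErr b θ (i + 1) < 0) :
    ∃ K, ∀ i, K ≤ i → 1 ≤ b i ∧ 1 ≤ convDen b i ∧ convDen b i < convDen b (i + 1) ∧
      convErr b θ i * convErr b θ (i + 1) < 0 := by
  obtain ⟨K, hK⟩ := eventually_atTop.1
    ((eventually_one_le_of_largeOrPairOfOnes hpat).and hD)
  have hpos : ∀ i, K + 2 ≤ i → 1 ≤ convDen b i := by
    intro i hi
    obtain ⟨j, rfl⟩ := Nat.exists_eq_add_of_le hi
    have h0 := convDen_nonneg hb (K + j)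
    have h1 := convDen_nonneg hb (K + j + 1)
    have hdet := convNum_mul_convDen_sub b (K + j)
    have hbj := (hK (K + j) (by omega)).1
    have hne : convDen b (K + j) ≠ 0 ∨ convDen b (K + j + 1) ≠ 0 := by
      by_contra! h
      rw [h.1, h.2] at hdet
      simp at hdet
      exact absurd hdet.symm (pow_ne_zero _ (by norm_num))
    rw [show K + 2 + j = K + j + 2 by ring, convDen_add_two]
    have := mul_le_mul_of_nonneg_right hbj h1
    omega
  refine ⟨K + 3, fun i hi => ⟨(hK i (by omega)).1, hpos i (by omega), ?_, (hK i (by omega)).2⟩⟩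
  obtain ⟨j, rfl⟩ := Nat.exists_eq_add_of_le hi
  have h0 := hpos (K + 2 + j) (by omega)
  have h1 := hpos (K + 2 + j + 1) (by omega)
  have hbj := (hK (K + 2 + j) (by omega)).1
  rw [show K + 3 + j + 1 = K + 2 + j + 2 by ring, convDen_add_two,
    show K + 3 + j = K + 2 + j + 1 by ring]
  have := mul_le_mul_of_nonneg_right hbj (by omega : 0 ≤ convDen b (K + 2 + j + 1))
  omega

theorem convDen_ge {K : ℕ} (hK : ∀ i, K ≤ i → 1 ≤ convDen b i ∧ convDen b i < convDen b (i + 1))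
    (j : ℕ) : (j : ℤ) ≤ convDen b (K + j) := by
  induction j with
  | zero => have := (hK K le_rfl).1; simp; omega
  | succ j ih => have := (hK (K + j) (by omega)).2; push_cast; rw [← add_assoc]; omega

/-- Legendre's criterion: a pair `(P, Q)` with `|Q| |Q θ - P| < 1 / 2` is a multiple of a
convergent, as soon as `|Q|` lies in the range where the convergents behave regularly. -/
theorem legendre {K : ℕ} (hK : ∀ i, K ≤ i → 1 ≤ convDen b i ∧ convDen b i < convDen b (i + 1) ∧
      convErr b θ i * convErr b θ (i + 1) < 0)
    {P Q : ℤ} (hQ : convDen b K ≤ |Q|) (hw : |(Q : ℝ)| * |Q * θ - P| < 1 / 2) :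
    ∃ i, K ≤ i ∧ ∃ d : ℤ, P = d * convNum b i ∧ Q = d * convDen b i := by
  have hex : ∃ j, |Q| < convDen b (K + j) := by
    refine ⟨(|Q|).toNat + 1, lt_of_lt_of_le ?_
      (convDen_ge (fun i hi => ⟨(hK i hi).1, (hK i hi).2.1⟩) _)⟩
    push_cast
    have := Int.self_le_toNat |Q|
    omega
  classical
  obtain ⟨i, hi, hQi, hQi'⟩ : ∃ i, K ≤ i ∧ convDen b i ≤ |Q| ∧ |Q| < convDen b (i + 1) := by
    have h1 := Nat.find_spec hex
    have h2 : Nat.find hex ≠ 0 := fun h => by rw [h] at h1; simp at h1; omega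
    obtain ⟨j, hj⟩ := Nat.exists_eq_succ_of_ne_zero h2
    refine ⟨K + j, by omega, ?_, ?_⟩
    · have := Nat.find_min hex (m := j) (by omega)
      omega
    · rw [hj] at h1; exact h1
  refine ⟨i, hi, ?_⟩
  have hdet := convNum_mul_convDen_sub b i
  obtain ⟨hq1, hqlt, hDD⟩ := hK i hi
  have hs : ((-1 : ℤ) ^ i) * (-1) ^ i = 1 := by rw [← mul_pow]; simp
  set p := convNum b i
  set q := convDen b i
  set p' := convNum b (i + 1)
  set q' := convDen b (i + 1)
  -- Coordinates of `(P, Q)` with respect to two consecutive convergents.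
  set x : ℤ := (-1) ^ i * (p' * Q - q' * P) with hx
  set y : ℤ := (-1) ^ i * (q * P - p * Q) with hy
  have hPx : P = x * p + y * p' := by
    rw [hx, hy]; linear_combination (-P) * hs - (-1) ^ i * P * hdet
  have hQx : Q = x * q + y * q' := by
    rw [hx, hy]; linear_combination (-Q) * hs - (-1) ^ i * Q * hdet
  by_cases hy0 : y = 0
  · exact ⟨x, by rw [hPx, hy0]; ring, by rw [hQx, hy0]; ring⟩
  exfalso
  have hxy : x * y < 0 := by
    by_contra! h
    have h1 : q' ^ 2 ≤ Q ^ 2 := by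
      have hy1 : 1 ≤ y ^ 2 := by have := sq_pos_of_ne_zero hy0; omega
      have : 0 ≤ x * y * (q * q') := mul_nonneg h (mul_nonneg (by omega) (by omega))
      rw [hQx]; nlinarith [sq_nonneg (x * q), mul_le_mul_of_nonneg_right hy1 (sq_nonneg q')]
    have := sq_le_sq.1 h1
    rw [abs_of_nonneg (by omega : 0 ≤ q')] at this
    omega
  have hx1 : 1 ≤ x ^ 2 := by
    have : x ≠ 0 := fun h => by simp [h] at hxy
    have := sq_pos_of_ne_zero this
    omega
  have hE : (Q : ℝ) * θ - P = x * convErr b θ i + y * convErr b θ (i + 1) := by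
    rw [convErr_eq, convErr_eq, hPx, hQx]; push_cast; ring
  have hle : |convErr b θ i| ≤ |Q * θ - P| := by
    apply sq_le_sq.1
    have h1 : 0 < ((x * y : ℤ) : ℝ) * (convErr b θ i * convErr b θ (i + 1)) :=
      mul_pos_of_neg_of_neg (by exact_mod_cast hxy) hDD
    have h2 : (1 : ℝ) ≤ (x : ℝ) ^ 2 := by exact_mod_cast hx1
    push_cast at h1
    rw [hE]
    nlinarith [sq_nonneg (y * convErr b θ (i + 1)),
      mul_le_mul_of_nonneg_right h2 (sq_nonneg (convErr b θ i))]
  have hdet1 : (1 : ℝ) ≤ |(q : ℝ) * P - p * Q| := by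
    have : (1 : ℤ) ≤ |q * P - p * Q| := by
      apply Int.one_le_abs
      intro h
      exact hy0 (by rw [hy, h]; ring)
    exact_mod_cast this
  have hid : (q : ℝ) * P - p * Q = Q * convErr b θ i - q * (Q * θ - P) := by
    rw [convErr_eq]; ring
  have hqQ : (q : ℝ) ≤ |(Q : ℝ)| := by exact_mod_cast hQi
  have hq0 : (0 : ℝ) ≤ q := by exact_mod_cast (by omega : 0 ≤ q)
  have : |(Q : ℝ) * convErr b θ i - q * (Q * θ - P)| ≤
      |(Q : ℝ)| * |Q * θ - P| + |(Q : ℝ)| * |Q * θ - P| := by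
    refine (abs_sub _ _).trans ?_
    rw [abs_mul, abs_mul, abs_of_nonneg hq0]
    gcongr
  rw [hid] at hdet1
  linarith

/-- The quantity `q_i |q_i θ - p_i|` is close to `0` when the next partial quotient is large, and
close to `1 / 2` next to or inside a pair `1, 1`. -/
theorem eventually_convDen_mul_abs_convErr (hb : ∀ i, 1 ≤ i → 0 ≤ b i)
    (hpat : LargeOrPairOfOnes b)
    (hD : ∀ᶠ i in atTop, convErr b θ i * convErr b θ (i + 1) < 0) {ε : ℝ} (hε : 0 < ε) :
    ∀ᶠ i in atTop, convDen b i * |convErr b θ i| ≤ ε ∨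
      |convDen b i * |convErr b θ i| - 1 / 2| ≤ ε := by
  obtain ⟨K, hK⟩ := exists_regular hb hpat hD
  obtain ⟨A, hA⟩ := exists_nat_gt (1 / ε)
  obtain ⟨N, hN⟩ := eventually_atTop.1 (hpat A)
  have hAε : 1 ≤ ε * A := by
    rw [div_lt_iff₀ hε] at hA; linarith
  refine eventually_atTop.2 ⟨K + N + 3, fun i hi => ?_⟩
  obtain ⟨m, rfl⟩ : ∃ m, i = m + 3 := ⟨i - 3, by omega⟩
  -- Absolute values of the remainders satisfy the recurrence with a minus sign.
  have hrec : ∀ i, K ≤ i →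
      |convErr b θ i| = b i * |convErr b θ (i + 1)| + |convErr b θ (i + 2)| := by
    intro i hi
    have h1 := (hK i hi).2.2.2
    have h2 := (hK (i + 1) (by omega)).2.2.2
    rw [show i + 1 + 1 = i + 2 by ring] at h2
    have h3 := convErr_add_two b θ i
    rcases lt_or_gt_of_ne (left_ne_zero_of_mul h1.ne) with h | h
    · have h4 := pos_of_mul_neg_right h1 h.le
      have h5 := neg_of_mul_neg_right h2 h4.le
      rw [abs_of_neg h, abs_of_pos h4, abs_of_neg h5]; linarith
    · have h4 := neg_of_mul_neg_right h1 h.le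
      have h5 := pos_of_mul_neg_right h2 h4.le
      rw [abs_of_pos h, abs_of_neg h4, abs_of_pos h5]; linarith
  have hone : ∀ i, K ≤ i →
      convDen b (i + 1) * |convErr b θ i| + convDen b i * |convErr b θ (i + 1)| = 1 := by
    intro i hi
    have hdet : convDen b (i + 1) * convErr b θ i - convDen b i * convErr b θ (i + 1) =
        (-1) ^ i := by
      have : ((convNum b (i + 1) * convDen b i - convNum b i * convDen b (i + 1) : ℤ) : ℝ)
          = (-1) ^ i := by rw [convNum_mul_convDen_sub]; push_cast; rfl
      push_cast at this
      rw [← this, convErr_eq, convErr_eq]; ring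
    have h1 := (hK i hi).2.2.2
    have q0 : (0 : ℝ) < convDen b i := by exact_mod_cast (hK i hi).2.1
    have q1 : (0 : ℝ) < convDen b (i + 1) := by exact_mod_cast (hK (i + 1) (by omega)).2.1
    have h := congrArg abs hdet
    rw [abs_pow, abs_neg, abs_one, one_pow] at h
    rcases lt_or_gt_of_ne (left_ne_zero_of_mul h1.ne) with h' | h'
    · have h4 := pos_of_mul_neg_right h1 h'.le
      rw [abs_of_nonpos] at h
      · rw [abs_of_neg h', abs_of_pos h4]; linarith
      · nlinarith
    · have h4 := neg_of_mul_neg_right h1 h'.le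
      rw [abs_of_nonneg] at h
      · rw [abs_of_pos h', abs_of_neg h4]; linarith
      · nlinarith
  have hq0 : ∀ i, K ≤ i → (0 : ℝ) ≤ convDen b i := fun i hi => by
    exact_mod_cast zero_le_one.trans (hK i hi).2.1
  have hqrec : ∀ i, (convDen b (i + 2) : ℝ) = b i * convDen b (i + 1) + convDen b i := by
    intro i; rw [convDen_add_two]; push_cast; rfl
  have hsmall : ∀ z : ℝ, 0 ≤ z → A * z ≤ 1 → z ≤ ε := by
    intro z hz h
    nlinarith [mul_le_mul_of_nonneg_right hAε hz, mul_le_mul_of_nonneg_left h hε.le]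
  have hcast : ∀ i, (A : ℤ) ≤ b i → (A : ℝ) ≤ b i := fun i h => by exact_mod_cast h
  have hq1 := hq0 (m + 1) (by omega)
  have hq2 := hq0 (m + 2) (by omega)
  have hq3 := hq0 (m + 3) (by omega)
  have hQ2 := hqrec m
  have hQ3 : (convDen b (m + 3) : ℝ) = b (m + 1) * convDen b (m + 2) + convDen b (m + 1) :=
    hqrec (m + 1)
  have hQ4 : (convDen b (m + 4) : ℝ) = b (m + 2) * convDen b (m + 3) + convDen b (m + 2) :=
    hqrec (m + 2)
  have hD3 : |convErr b θ (m + 3)| = b (m + 3) * |convErr b θ (m + 4)| + |convErr b θ (m + 5)| :=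
    hrec (m + 3) (by omega)
  have hD4 : |convErr b θ (m + 4)| = b (m + 4) * |convErr b θ (m + 5)| + |convErr b θ (m + 6)| :=
    hrec (m + 4) (by omega)
  have h1 : convDen b (m + 4) * |convErr b θ (m + 3)| +
      convDen b (m + 3) * |convErr b θ (m + 4)| = 1 := hone (m + 3) (by omega)
  have hq4 := hq0 (m + 4) (by omega)
  have hq00 := hq0 m (by omega)
  have hpatm := hN m (by omega)
  have d3 := abs_nonneg (convErr b θ (m + 3))
  have d4 := abs_nonneg (convErr b θ (m + 4))
  have d5 := abs_nonneg (convErr b θ (m + 5))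
  have d6 := abs_nonneg (convErr b θ (m + 6))
  generalize (|convErr b θ (m + 3)|) = D3 at *
  generalize (|convErr b θ (m + 4)|) = D4 at *
  generalize (|convErr b θ (m + 5)|) = D5 at *
  generalize (|convErr b θ (m + 6)|) = D6 at *
  generalize (convDen b m : ℝ) = q0 at *
  generalize (convDen b (m + 1) : ℝ) = q1 at *
  generalize (convDen b (m + 2) : ℝ) = q2 at *
  generalize (convDen b (m + 3) : ℝ) = q3 at *
  generalize (convDen b (m + 4) : ℝ) = q4 at *
  have h34 := mul_nonneg hq3 d4
  have h43 := mul_nonneg hq4 d3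
  rcases hpatm with h | ⟨e2, e3, ha, hb'⟩ | ⟨e1, e2, ha, hb'⟩
  · left
    refine hsmall _ (mul_nonneg hq3 d3) ?_
    have h2 := mul_le_mul_of_nonneg_right (hcast _ h) (mul_nonneg hq3 d3)
    have h3 := mul_nonneg hq2 d3
    rw [hQ4] at h1
    linarith
  · right
    rw [e2] at hQ4
    rw [e3] at hD3
    have ha2 := mul_le_mul_of_nonneg_right (hcast _ ha) hq2
    have hb5 := mul_le_mul_of_nonneg_right (hcast _ hb') d5
    push_cast at hQ4 hD3
    have z1 : q2 * D3 ≤ ε := by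
      refine hsmall _ (mul_nonneg hq2 d3) ?_
      have h2 := mul_le_mul_of_nonneg_right (by linarith : A * q2 ≤ q4) d3
      linarith
    have z2 : q3 * D5 ≤ ε := by
      refine hsmall _ (mul_nonneg hq3 d5) ?_
      have h2 := mul_le_mul_of_nonneg_left (by linarith : A * D5 ≤ D4) hq3
      linarith
    have h5 : 1 - 2 * (q3 * D3) = q2 * D3 - q3 * D5 := by
      rw [← h1, hQ4]
      linear_combination (-q3) * hD3
    have := mul_nonneg hq2 d3
    have := mul_nonneg hq3 d5
    rw [abs_le]
    constructor <;> linarith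
  · right
    rw [e2] at hQ4
    rw [e1] at hQ3
    have ha1 := mul_le_mul_of_nonneg_right (hcast _ ha) hq1
    have hb4 := mul_le_mul_of_nonneg_right (hcast _ hb') d4
    push_cast at hQ4 hQ3
    have z1 : q1 * D3 ≤ ε := by
      refine hsmall _ (mul_nonneg hq1 d3) ?_
      have h2 := mul_le_mul_of_nonneg_right (by linarith : A * q1 ≤ q4) d3
      linarith
    have z2 : q3 * D4 ≤ ε := by
      refine hsmall _ (mul_nonneg hq3 d4) ?_
      have h2 := mul_le_mul_of_nonneg_left (by linarith : A * D4 ≤ D3) hq3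
      have h3 := mul_le_mul_of_nonneg_right (by linarith : q3 ≤ q4) d3
      linarith
    have h5 : 1 - 2 * (q3 * D3) = q3 * D4 - q1 * D3 := by
      rw [← h1, hQ4]
      linear_combination (-D3) * hQ3
    have := mul_nonneg hq1 d3
    have := mul_nonneg hq3 d4
    rw [abs_le]
    constructor <;> linarith

end Convergents

/-! ### The approximation constant as a lower limit over residue classes -/

theorem residue_identity {θ : ℝ} {n : ℕ} (hn : n ≠ 0) (u v q p : ℤ) :
    (n : ℝ) ^ 2 * (|(q : ℝ)| * |q * θ - (u - v * θ) / n - p|) =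
      |((n * q + v : ℤ) : ℝ) - v| * |((n * q + v : ℤ) : ℝ) * θ - (n * p + u : ℤ)| := by
  have hn' : (0 : ℝ) < n := by positivity
  have h1 : (((n * q + v : ℤ) : ℝ)) * θ - (n * p + u : ℤ) = n * (q * θ - (u - v * θ) / n - p) := by
    push_cast; field_simp; ring
  have h2 : ((n * q + v : ℤ) : ℝ) - v = n * q := by push_cast; ring
  rw [h1, h2, abs_mul, abs_mul, abs_of_pos hn']
  ring

/-- The factor `n²` turns `|q| ‖q θ - φ‖` into `|Q| |Q θ - P|`, for pairs `(P, Q)` in a fixed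
residue class modulo `n`; replacing `|n q|` by `|Q| = |n q + v|` does not change lower limits. -/
theorem sq_mul_inhomApproxConst_le {θ r : ℝ} {n : ℕ} (hn : n ≠ 0) {u v : ℤ} (hv : |v| ≤ 1)
    (h : ∀ N : ℤ, ∃ P Q : ℤ, P ≡ u [ZMOD n] ∧ Q ≡ v [ZMOD n] ∧ N ≤ |Q| ∧
      |(Q : ℝ)| * |Q * θ - P| ≤ r) :
    (n : ℝ≥0∞) ^ 2 * inhomApproxConst θ ((u - v * θ) / n) ≤ ENNReal.ofReal r := by
  have hn' : (0 : ℝ) < n := by positivity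
  have hr : 0 ≤ r := by
    obtain ⟨P, Q, -, -, -, h⟩ := h 0
    exact le_trans (by positivity) h
  refine ENNReal.le_of_forall_pos_le_add fun ε hε _ => ?_
  have hε' : (0 : ℝ) < ε := hε
  have key : inhomApproxConst θ ((u - v * θ) / n) ≤ ENNReal.ofReal ((r + ε) / n ^ 2) := by
    refine liminf_le_of_frequently_le' ?_
    rw [frequently_comap, frequently_atTop]
    intro N
    obtain ⟨M, hM⟩ := exists_nat_gt (r / ε)
    obtain ⟨P, Q, hP, hQ, hQN, hw⟩ := h (n * |N| + M + 1)
    obtain ⟨p, hp⟩ := hP.symm.dvd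
    obtain ⟨q, hq⟩ := hQ.symm.dvd
    obtain rfl : P = n * p + u := by linarith
    obtain rfl : Q = n * q + v := by linarith
    refine ⟨|q|, ?_, q, rfl, ?_⟩
    · have h1 : |(n : ℤ) * q + v| ≤ n * |q| + 1 :=
        (abs_add_le _ _).trans (by rw [abs_mul, Nat.abs_cast]; gcongr)
      have h2 : (n : ℤ) * |N| ≤ n * |q| := by omega
      exact (le_abs_self N).trans (le_of_mul_le_mul_left h2 (by positivity))
    · refine ENNReal.ofReal_le_ofReal ?_
      rw [le_div_iff₀ (by positivity), mul_comm]
      have h1 : distNearestInt (q * θ - (u - v * θ) / n) ≤ |q * θ - (u - v * θ) / n - p| :=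
        round_le _ _
      calc _ ≤ (n : ℝ) ^ 2 * (|(q : ℝ)| * |q * θ - (u - v * θ) / n - p|) := by
            gcongr
        _ = _ := residue_identity hn u v q p
        _ ≤ r + ε := ?_
      set Q : ℤ := n * q + v
      set P : ℤ := n * p + u
      have hv' : |(v : ℝ)| ≤ 1 := by exact_mod_cast hv
      have h2 : |(Q : ℝ) - v| ≤ |(Q : ℝ)| + 1 := (abs_sub _ _).trans (by gcongr)
      have h3 : (M : ℝ) ≤ |(Q : ℝ)| := by
        have : (M : ℤ) ≤ |Q| := by
          have : 0 ≤ (n : ℤ) * |N| := by positivity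
          omega
        exact_mod_cast this
      have hd : 0 ≤ |Q * θ - P| := abs_nonneg _
      have h4 : |Q * θ - P| ≤ ε := by
        rw [div_lt_iff₀ hε'] at hM
        by_contra! hlt
        have : 0 < (M : ℝ) := by
          rcases Nat.eq_zero_or_pos M with h0 | h0
          · rw [h0] at hM; simp at hM; linarith
          · exact_mod_cast h0
        have := mul_lt_mul_of_pos_left hlt this
        have := mul_le_mul_of_nonneg_right h3 hd
        linarith
      have := mul_le_mul_of_nonneg_right h2 hd
      linarith
  calc (n : ℝ≥0∞) ^ 2 * inhomApproxConst θ ((u - v * θ) / n)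
      ≤ ENNReal.ofReal (n ^ 2) * ENNReal.ofReal ((r + ε) / n ^ 2) := by
        rw [ENNReal.ofReal_pow hn'.le, ENNReal.ofReal_natCast]
        gcongr
    _ = ENNReal.ofReal (r + ε) := by
        rw [← ENNReal.ofReal_mul (by positivity), mul_div_cancel₀ _ (by positivity)]
    _ ≤ ENNReal.ofReal r + ε := by
        refine ENNReal.ofReal_add_le.trans ?_
        simp

theorem le_sq_mul_inhomApproxConst {θ r : ℝ} {n : ℕ} (hn : n ≠ 0) {u v : ℤ} (hv : |v| ≤ 1)
    (h : ∃ N : ℤ, ∀ P Q : ℤ, P ≡ u [ZMOD n] → Q ≡ v [ZMOD n] → N ≤ |Q| →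
      r ≤ |(Q : ℝ)| * |Q * θ - P|) :
    ENNReal.ofReal r ≤ (n : ℝ≥0∞) ^ 2 * inhomApproxConst θ ((u - v * θ) / n) := by
  have hn' : (0 : ℝ) < n := by positivity
  obtain ⟨N, hN⟩ := h
  refine ENNReal.le_of_forall_pos_le_add fun ε hε _ => ?_
  have hε' : (0 : ℝ) < ε := hε
  have key : ENNReal.ofReal ((r - ε) / n ^ 2) ≤ inhomApproxConst θ ((u - v * θ) / n) := by
    refine le_liminf_of_le (by isBoundedDefault) ?_
    rw [eventually_comap]
    obtain ⟨M, hM⟩ := exists_nat_gt (|r| / ε)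
    refine eventually_atTop.2 ⟨|N| + M + 2, ?_⟩
    rintro _ hQ q rfl
    refine ENNReal.ofReal_le_ofReal ?_
    rw [div_le_iff₀ (by positivity), mul_comm]
    set p := round (q * θ - (u - v * θ) / n) with hp
    have hid := residue_identity (θ := θ) hn u v q p
    have hbase := hN (n * p + u) (n * q + v) (by simp [Int.ModEq]) (by simp [Int.ModEq])
    have hQbig : |N| + M + 1 ≤ |(n : ℤ) * q + v| := by
      have h1 : |(n : ℤ) * q| ≤ |(n : ℤ) * q + v| + |v| := by
        simpa using abs_sub ((n : ℤ) * q + v) v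
      have h2 : 1 * |q| ≤ n * |q| :=
        mul_le_mul_of_nonneg_right (by exact_mod_cast Nat.pos_of_ne_zero hn) (abs_nonneg _)
      rw [abs_mul, Nat.abs_cast] at h1
      omega
    have hbase := hbase (by have := le_abs_self N; omega)
    unfold distNearestInt
    rw [← hp]
    push_cast at hid hbase ⊢
    rw [hid]
    have hQbig' : |(N : ℝ)| + M + 1 ≤ |(n : ℝ) * q + v| := by exact_mod_cast hQbig
    have hv' : |(v : ℝ)| ≤ 1 := by exact_mod_cast hv
    have hD := abs_nonneg (((n : ℝ) * q + v) * θ - (n * p + u))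
    generalize (n : ℝ) * q + v = Q at *
    generalize |Q * θ - (n * p + u)| = D at *
    have h1 : |Q| - 1 ≤ |Q - v| := by
      have := abs_sub_abs_le_abs_sub Q v
      linarith
    have hMQ : (M : ℝ) ≤ |Q| - 1 := by
      have := abs_nonneg (N : ℝ)
      linarith
    rw [div_lt_iff₀ hε'] at hM
    have hr := le_abs_self r
    rcases le_total D ε with hDε | hDε
    · have := mul_le_mul_of_nonneg_right h1 hD
      linarith
    · have := mul_le_mul_of_nonneg_right (hMQ.trans h1) hD
      have : (M : ℝ) * ε ≤ M * D := by gcongr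
      linarith
  calc ENNReal.ofReal r ≤ ENNReal.ofReal (r - ε) + ε := by
        rw [← ENNReal.ofReal_coe_nnreal]
        refine le_trans (le_of_eq ?_) ENNReal.ofReal_add_le
        rw [sub_add_cancel]
    _ = ENNReal.ofReal (n ^ 2) * ENNReal.ofReal ((r - ε) / n ^ 2) + ε := by
        rw [← ENNReal.ofReal_mul (by positivity), mul_div_cancel₀ _ (by positivity)]
    _ ≤ (n : ℝ≥0∞) ^ 2 * inhomApproxConst θ ((u - v * θ) / n) + ε := by
        rw [ENNReal.ofReal_pow hn'.le, ENNReal.ofReal_natCast]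
        gcongr

/-! ### Approximation in the residue classes of the convergents -/

/-- The dichotomy for a formal continued fraction `[b 0; b 1, …]` (zero partial quotients are
allowed) whose remainders with respect to `θ` alternate in sign from some point on. -/
theorem sq_mul_inhomApproxConst_eq_zero_or_half {b : ℕ → ℤ} {θ : ℝ} {n : ℕ} (hn : 2 ≤ n)
    (hb : ∀ i, 1 ≤ i → 0 ≤ b i) (hpat : LargeOrPairOfOnes b)
    (hD : ∀ᶠ i in atTop, convErr b θ i * convErr b θ (i + 1) < 0)
    (hper : CompletelyPeriodicMod n b) {φ : ℝ} (hφ : φ = 1 / (n : ℝ) ∨ φ = -θ / (n : ℝ)) :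
    (n : ℝ≥0∞) ^ 2 * inhomApproxConst θ φ = 0 ∨
      (n : ℝ≥0∞) ^ 2 * inhomApproxConst θ φ = 1 / 2 := by
  have hn0 : n ≠ 0 := by omega
  obtain ⟨K, hK⟩ := exists_regular hb hpat hD
  have hKge : ∀ j : ℕ, (j : ℤ) ≤ convDen b (K + j) :=
    convDen_ge fun i hi => ⟨(hK i hi).2.1, (hK i hi).2.2.1⟩
  -- Both choices of `φ` correspond to a residue class that contains infinitely many convergents.
  obtain ⟨u, v, hφ, hv, hne, hclass⟩ : ∃ u v : ℤ, φ = (u - v * θ) / n ∧ |v| ≤ 1 ∧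
      ¬ (u ≡ 0 [ZMOD n] ∧ v ≡ 0 [ZMOD n]) ∧
      ∀ N, ∃ i, N ≤ i ∧ convNum b i ≡ u [ZMOD n] ∧ convDen b i ≡ v [ZMOD n] := by
    have h10 : ¬ ((1 : ℤ) ≡ 0 [ZMOD n]) := by
      rw [Int.modEq_zero_iff_dvd]
      intro h
      have := Int.le_of_dvd one_pos h
      omega
    rcases hφ with rfl | rfl
    · refine ⟨1, 0, by simp, by simp, fun h => h10 h.1, fun N => ?_⟩
      obtain ⟨i, hi, -, h⟩ := exists_conv_modEq hn hper N
      exact ⟨i + 1, by omega, h⟩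
    · refine ⟨0, 1, by simp, by simp, fun h => h10 h.2, fun N => ?_⟩
      obtain ⟨i, hi, h, -⟩ := exists_conv_modEq hn hper N
      exact ⟨i, hi, h⟩
  have hw : ∀ i, K ≤ i → |(convDen b i : ℝ)| * |convDen b i * θ - convNum b i| =
      convDen b i * |convErr b θ i| := by
    intro i hi
    rw [convErr_eq, abs_of_nonneg]
    exact_mod_cast zero_le_one.trans (hK i hi).2.1
  have hev : ∀ ε : ℝ, 0 < ε → ∃ K', K ≤ K' ∧ ∀ i, K' ≤ i → convDen b i * |convErr b θ i| ≤ ε ∨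
      |convDen b i * |convErr b θ i| - 1 / 2| ≤ ε := by
    intro ε hε
    obtain ⟨K', hK'⟩ := eventually_atTop.1 (eventually_convDen_mul_abs_convErr hb hpat hD hε)
    exact ⟨max K K', le_max_left _ _, fun i hi => hK' i (le_trans (le_max_right _ _) hi)⟩
  have hupper : (n : ℝ≥0∞) ^ 2 * inhomApproxConst θ φ ≤ 1 / 2 := by
    refine ENNReal.le_of_forall_pos_le_add fun ε hε _ => ?_
    have hε' : (0 : ℝ) < ε := hε
    have : (1 / 2 : ℝ≥0∞) + ε = ENNReal.ofReal (1 / 2 + ε) := by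
      rw [ENNReal.ofReal_add (by norm_num) hε'.le, ENNReal.ofReal_coe_nnreal,
        ENNReal.ofReal_div_of_pos two_pos]
      simp
    rw [this, hφ]
    refine sq_mul_inhomApproxConst_le hn0 hv fun N => ?_
    obtain ⟨K', hKK', hK'⟩ := hev ε hε'
    obtain ⟨i, hi, hP, hQ⟩ := hclass (K' + N.toNat)
    refine ⟨_, _, hP, hQ, ?_, ?_⟩
    · obtain ⟨j, rfl⟩ : ∃ j, i = K + j := ⟨i - K, by omega⟩
      have h1 := hKge j
      have h2 := le_abs_self (convDen b (K + j))
      omega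
    · rw [hw i (by omega)]
      rcases hK' i (by omega) with h | h
      · linarith
      · linarith [(abs_le.1 h).2]
  by_cases hsmall : ∀ ε : ℝ, 0 < ε → ∀ N : ℤ, ∃ P Q : ℤ, P ≡ u [ZMOD n] ∧ Q ≡ v [ZMOD n] ∧
      N ≤ |Q| ∧ |(Q : ℝ)| * |Q * θ - P| ≤ ε
  · left
    refine le_antisymm (ENNReal.le_of_forall_pos_le_add fun ε hε _ => ?_) zero_le
    have hε' : (0 : ℝ) < ε := hε
    rw [hφ, zero_add, ← ENNReal.ofReal_coe_nnreal]
    exact sq_mul_inhomApproxConst_le hn0 hv (hsmall ε hε')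
  · right
    refine le_antisymm hupper ?_
    push Not at hsmall
    obtain ⟨ε₀, hε₀, N₀, hN₀⟩ := hsmall
    refine ENNReal.le_of_forall_pos_le_add fun ε hε _ => ?_
    have hε' : (0 : ℝ) < ε := hε
    have hlow : ENNReal.ofReal (1 / 2 - ε) ≤ (n : ℝ≥0∞) ^ 2 * inhomApproxConst θ φ := by
      rw [hφ]
      refine le_sq_mul_inhomApproxConst hn0 hv ?_
      obtain ⟨K', hKK', hK'⟩ := hev (min ε (ε₀ / n ^ 2)) (by positivity)
      set K'' := K' + N₀.toNat with hK''
      refine ⟨convDen b K'', fun P Q hP hQ hQK => ?_⟩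
      by_contra! hlt
      obtain ⟨i, hi, d, rfl, rfl⟩ := legendre (K := K'')
        (fun i hi => (hK i (by omega)).2) hQK (hlt.trans (by linarith))
      obtain ⟨j, rfl⟩ : ∃ j, i = K + j := ⟨i - K, by omega⟩
      have hj := hKge j
      set i := K + j
      -- The multiplier `d` may be replaced by its residue, so that it is bounded.
      set e := d % n with he
      have hed : e ≡ d [ZMOD n] := Int.mod_modEq _ _
      have he0 : 0 ≤ e := Int.emod_nonneg _ (by omega)
      have hen : e < n := Int.emod_lt_of_pos _ (by omega)
      have heP := (hed.mul_right (convNum b i)).trans hP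
      have heQ := (hed.mul_right (convDen b i)).trans hQ
      have he1 : 1 ≤ e := by
        by_contra! h
        obtain h0 : e = 0 := by omega
        rw [h0, zero_mul] at heP heQ
        exact hne ⟨heP.symm, heQ.symm⟩
      have hd0 : d ≠ 0 := by
        rintro h
        rw [h] at he
        simp at he
        omega
      have hq1 : 1 ≤ convDen b i := (hK i (by omega)).2.1
      have hmul : ∀ x : ℤ, |((x * convDen b i : ℤ) : ℝ)| *
          |((x * convDen b i : ℤ) : ℝ) * θ - (x * convNum b i : ℤ)| =
          (x : ℝ) ^ 2 * (convDen b i * |convErr b θ i|) := by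
        intro x
        rw [← hw i (by omega)]
        push_cast
        rw [show (x : ℝ) * convDen b i * θ - x * convNum b i =
          x * (convDen b i * θ - convNum b i) by ring, abs_mul, abs_mul, ← sq_abs (x : ℝ)]
        ring
      have hbig := hN₀ _ _ heP heQ (by
        have : 1 * convDen b i ≤ e * convDen b i := mul_le_mul_of_nonneg_right he1 (by omega)
        have := le_abs_self (e * convDen b i)
        omega)
      rw [hmul] at hbig hlt
      set w := convDen b i * |convErr b θ i|
      have hw0 : 0 ≤ w := mul_nonneg (by exact_mod_cast (by omega : 0 ≤ convDen b i))
        (abs_nonneg _)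
      have hen2 : (e : ℝ) ^ 2 ≤ n ^ 2 := by
        have h1 : (0 : ℝ) ≤ e := by exact_mod_cast he0
        have h2 : (e : ℝ) ≤ n := by exact_mod_cast hen.le
        gcongr
      have hwbig : ε₀ / n ^ 2 < w := by
        rw [div_lt_iff₀ (by positivity)]
        have := mul_le_mul_of_nonneg_right hen2 hw0
        linarith
      have hwhalf : 1 / 2 - ε ≤ w := by
        rcases hK' i (by omega) with h | h
        · linarith [min_le_right (ε : ℝ) (ε₀ / n ^ 2)]
        · linarith [(abs_le.1 h).1, min_le_left (ε : ℝ) (ε₀ / n ^ 2)]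
      have hd1 : (1 : ℝ) ≤ (d : ℝ) ^ 2 := by
        have : 1 ≤ d ^ 2 := by have := sq_pos_of_ne_zero hd0; omega
        exact_mod_cast this
      have := mul_le_mul_of_nonneg_right hd1 hw0
      linarith
    calc (1 / 2 : ℝ≥0∞) = ENNReal.ofReal (1 / 2) := by
          rw [ENNReal.ofReal_div_of_pos two_pos]; simp
      _ ≤ ENNReal.ofReal (1 / 2 - ε) + ε := by
          rw [← ENNReal.ofReal_coe_nnreal]
          refine le_trans (le_of_eq ?_) ENNReal.ofReal_add_le
          rw [sub_add_cancel]
      _ ≤ _ := by gcongr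

/-! ### Regular continued fractions -/

theorem HasPartialQuotients.head_tail {x : ℝ} {b : ℕ → ℤ} (hx : Irrational x)
    (h : HasPartialQuotients x b) :
    b 0 = ⌊x⌋ ∧ HasPartialQuotients (Int.fract x)⁻¹ (fun i => b (i + 1)) := by
  have hf : Int.fract x ≠ 0 := fun h0 => hx ⟨⌊x⌋, by
    rw [Int.fract, sub_eq_zero] at h0; exact_mod_cast h0.symm⟩
  obtain ⟨h0, hs⟩ := h
  rw [GenContFract.of_h_eq_floor] at h0
  refine ⟨by exact_mod_cast h0.symm, ?_, fun i => ?_⟩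
  · have := hs 0
    have hhead : (GenContFract.of x).s.get? 0 = some ⟨1, ⌊(Int.fract x)⁻¹⌋⟩ :=
      GenContFract.of_s_head hf
    rw [GenContFract.partDens, Stream'.Seq.map_get?, hhead] at this
    rw [GenContFract.of_h_eq_floor]
    exact Option.some.inj this
  · have := hs (i + 1)
    rw [GenContFract.partDens, Stream'.Seq.map_get?, GenContFract.of_s_succ] at this
    rw [GenContFract.partDens, Stream'.Seq.map_get?, this]

theorem irrational_inv_fract {x : ℝ} (hx : Irrational x) : Irrational (Int.fract x)⁻¹ := by
  rw [Int.fract, irrational_inv_iff]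
  exact hx.sub_intCast _

/-- The complete quotients `x i = [b i; b (i + 1), …]` of an irrational number. -/
theorem HasPartialQuotients.exists_complete_quotients {θ : ℝ} {b : ℕ → ℤ} (hθ : Irrational θ)
    (h : HasPartialQuotients θ b) :
    ∃ x : ℕ → ℝ, x 0 = θ ∧ (∀ i, b i = ⌊x i⌋) ∧ (∀ i, Irrational (x i)) ∧
      ∀ i, x (i + 1) = (Int.fract (x i))⁻¹ := by
  let x : ℕ → ℝ := fun i => Nat.rec θ (fun _ y => (Int.fract y)⁻¹) i
  have hx : ∀ i, Irrational (x i) ∧ HasPartialQuotients (x i) (fun j => b (j + i)) := by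
    intro i
    induction i with
    | zero => exact ⟨hθ, h⟩
    | succ i ih =>
      refine ⟨irrational_inv_fract ih.1, ?_⟩
      have := (ih.2.head_tail ih.1).2
      simpa only [add_right_comm _ 1 i, ← add_assoc] using this
  refine ⟨x, rfl, fun i => ?_, fun i => (hx i).1, fun i => rfl⟩
  simpa using ((hx i).2.head_tail (hx i).1).1

theorem HasPartialQuotients.one_le {θ : ℝ} {b : ℕ → ℤ} (hθ : Irrational θ)
    (h : HasPartialQuotients θ b) {i : ℕ} (hi : 1 ≤ i) : 1 ≤ b i := by
  obtain ⟨x, -, hb, hx, hs⟩ := h.exists_complete_quotients hθ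
  obtain ⟨j, rfl⟩ := Nat.exists_eq_add_of_le' hi
  have hpos : 0 < Int.fract (x j) :=
    (Int.fract_nonneg _).lt_of_ne fun h0 => (hx (j + 1)).ne_zero (by rw [hs, ← h0, inv_zero])
  rw [hb, Int.le_floor, hs, Int.cast_one]
  exact (one_le_inv₀ hpos).2 (Int.fract_lt_one _).le

/-- The remainders of the regular continued fraction satisfy `D_{i+1} = -D_i / x_i`, where `x_i` is
the `i`-th complete quotient, positive for `i ≥ 1`; so they alternate in sign. -/
theorem HasPartialQuotients.convErr_mul_neg {θ : ℝ} {b : ℕ → ℤ} (hθ : Irrational θ)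
    (h : HasPartialQuotients θ b) {i : ℕ} (hi : 1 ≤ i) :
    convErr b θ i * convErr b θ (i + 1) < 0 := by
  obtain ⟨x, h0, hb, hx, hs⟩ := h.exists_complete_quotients hθ
  have key : ∀ i, convErr b θ (i + 1) ≠ 0 ∧ convErr b θ i = -x i * convErr b θ (i + 1) := by
    intro i
    induction i with
    | zero => simp [convErr, convSeq, h0]
    | succ i ih =>
      have hf : Int.fract (x i) ≠ 0 := fun hf => (hx (i + 1)).ne_zero (by rw [hs, hf, inv_zero])
      have hr : convErr b θ (i + 2) = -Int.fract (x i) * convErr b θ (i + 1) := by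
        rw [convErr_add_two, ih.2, hb, Int.fract]; ring
      refine ⟨?_, ?_⟩
      · rw [hr]; exact mul_ne_zero (neg_ne_zero.2 hf) ih.1
      · rw [hr, hs]; field_simp
  have h1 : 0 < x i := by
    have h2 := h.one_le hθ hi
    rw [hb, Int.le_floor] at h2
    push_cast at h2
    linarith
  obtain ⟨hne, he⟩ := key i
  rw [he]
  have := mul_pos h1 (pow_pos (abs_pos.2 hne) 2)
  rw [sq_abs] at this
  linarith

/-! ### Sequences in block form -/

theorem blockSum_succ (len : ℕ → ℕ) (j : ℕ) :
    blockSum len (j + 1) = blockSum len j + len (j + 1) := by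
  simp [blockSum, Finset.sum_range_succ]

theorem blockSum_mono (len : ℕ → ℕ) : Monotone (blockSum len) :=
  monotone_nat_of_le_succ fun j => by rw [blockSum_succ]; omega

theorem exists_block (len : ℕ → ℕ) (i : ℕ) :
    ∃ j t, t ≤ len (j + 1) ∧ i = blockSum len j + j + t := by
  induction i with
  | zero => exact ⟨0, 0, by simp, by simp [blockSum]⟩
  | succ i ih =>
    obtain ⟨j, t, ht, rfl⟩ := ih
    rcases ht.lt_or_eq with h | h
    · exact ⟨j, t + 1, h, by ring⟩
    · exact ⟨j + 1, 0, by simp, by rw [blockSum_succ, h]; ring⟩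

/-- In the blocks that lie far enough to the right all terms are at most `1`. -/
theorem HasBlockForm.eventually_small_le_one {b a c : ℕ → ℤ} {len : ℕ → ℕ}
    (h : HasBlockForm b a c len) :
    ∃ J, ∀ j, J ≤ j → ∀ t, 1 ≤ t → t ≤ len (j + 1) → c (blockSum len j + t) ≤ 1 := by
  by_cases hbdd : ∃ K, ∀ j, blockSum len j ≤ K
  · -- The total length of the blocks is finite, so the blocks are eventually empty.
    obtain ⟨K, hK⟩ := hbdd
    have hbd : BddAbove (Set.range (blockSum len)) := ⟨K, by rintro _ ⟨j, rfl⟩; exact hK j⟩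
    obtain ⟨J, hJ⟩ := Nat.sSup_mem (Set.range_nonempty _) hbd
    refine ⟨J, fun j hj t h1 h2 => ?_⟩
    have h3 := le_csSup hbd ⟨j + 1, rfl⟩
    have h4 := blockSum_mono len hj
    rw [← hJ, blockSum_succ] at h3
    omega
  · have hlim := h.small_finite_or_limsup.resolve_left hbdd
    -- An empty or unbounded set of eventual bounds would have infimum `0`.
    have hne : {x : ℤ | ∀ᶠ i in atTop, c i ≤ x}.Nonempty := by
      by_contra! hempty
      rw [limsup_eq, hempty] at hlim
      simp at hlim
    have hbelow : BddBelow {x : ℤ | ∀ᶠ i in atTop, c i ≤ x} := by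
      by_contra hb
      rw [limsup_eq, Int.csInf_of_not_bddBelow hb] at hlim
      simp at hlim
    have hmem := Int.csInf_mem hne hbelow
    rw [← limsup_eq, hlim] at hmem
    obtain ⟨I, hI⟩ := eventually_atTop.1 hmem
    push Not at hbdd
    obtain ⟨J, hJ⟩ := hbdd I
    exact ⟨J, fun j hj t _ _ => hI _ (by have := blockSum_mono len hj; omega)⟩

theorem HasBlockForm.largeOrPairOfOnes {b a c : ℕ → ℤ} {len : ℕ → ℕ}
    (h : HasBlockForm b a c len) (hb : ∀ i, 1 ≤ i → 1 ≤ b i)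
    (hlen : ∀ i, 1 ≤ i → len i = 0 ∨ len i = 2) : LargeOrPairOfOnes b := by
  intro A
  obtain ⟨J, hJ⟩ := h.eventually_small_le_one
  obtain ⟨J', hJ'⟩ := eventually_atTop.1 (h.tendsto_large.eventually_ge_atTop A)
  refine eventually_atTop.2 ⟨blockSum len (J + J') + (J + J') , fun i hi => ?_⟩
  obtain ⟨j, t, ht, hij⟩ := exists_block len (i + 2)
  have hjJ : J + J' ≤ j := by
    by_contra! hlt
    have h1 := blockSum_mono len (show j + 1 ≤ J + J' from hlt)
    rw [blockSum_succ] at h1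
    omega
  have ha : A ≤ b (blockSum len j + j) := by rw [h.large]; exact hJ' _ (by omega)
  rcases Nat.eq_zero_or_pos t with rfl | htpos
  · left; rw [hij]; exact ha
  right
  have hl2 : len (j + 1) = 2 := by
    rcases hlen (j + 1) (by omega) with h0 | h0 <;> omega
  have hone : ∀ t, 1 ≤ t → t ≤ 2 → b (blockSum len j + j + t) = 1 := by
    intro t h1 h2
    refine le_antisymm ?_ (hb _ (by omega))
    rw [h.small j t h1 (by omega)]
    exact hJ j (by omega) t h1 (by omega)
  have ha' : A ≤ b (blockSum len j + j + 3) := by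
    have := h.large (j + 1)
    rw [blockSum_succ, hl2, show blockSum len j + 2 + (j + 1) = blockSum len j + j + 3 by ring]
      at this
    rw [this]
    exact hJ' _ (by omega)
  have h1 := hone 1 le_rfl (by omega)
  have h2 := hone 2 (by omega) le_rfl
  set s := blockSum len j + j
  obtain rfl | rfl : t = 1 ∨ t = 2 := by omega
  · left
    rw [show i + 1 = s by omega, hij, show i + 3 = s + 2 by omega, show i + 4 = s + 3 by omega]
    exact ⟨h1, h2, ha, ha'⟩
  · right
    rw [show i + 1 = s + 1 by omega, hij, show i = s by omega, show s + 3 = s + 3 by omega]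
    exact ⟨h1, h2, ha, ha'⟩

/-! ### Padé remainders of the exponential function -/

/-- The integral `c^{j+1} / j! ∫₀¹ (t (1 - t))^j e^{c t} dt`, the remainder of the `j`-th diagonal
Padé approximation of `exp` at `c`. -/
noncomputable def padeRem (c : ℝ) (j : ℕ) : ℝ :=
  c ^ (j + 1) * ∫ t in (0 : ℝ)..1, (t * (1 - t)) ^ j / j.factorial * Real.exp (c * t)

theorem padeRem_pos {c : ℝ} (hc : 0 < c) (j : ℕ) : 0 < padeRem c j := by
  refine mul_pos (pow_pos hc _) ?_
  refine intervalIntegral.intervalIntegral_pos_of_pos_on ?_ (fun t ht => ?_) one_pos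
  · exact Continuous.intervalIntegrable (by fun_prop) _ _
  · have h1 : 0 < t * (1 - t) := mul_pos ht.1 (by linarith [ht.2])
    positivity

theorem padeRem_zero {c : ℝ} (hc : 0 < c) : padeRem c 0 = Real.exp c - 1 := by
  have h : ∫ t in (0 : ℝ)..1, Real.exp (c * t) = Real.exp c / c - 1 / c := by
    rw [intervalIntegral.integral_eq_sub_of_hasDerivAt (f := fun t => Real.exp (c * t) / c)]
    · simp
    · intro t _
      have := (((hasDerivAt_id t).const_mul c).exp).div_const c
      simpa [hc.ne'] using this
    · exact Continuous.intervalIntegrable (by fun_prop) _ _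
  simp only [padeRem, zero_add, pow_one, pow_zero, Nat.factorial_zero, Nat.cast_one, div_one,
    one_mul, h]
  field_simp

theorem hasDerivAt_pow_div_factorial (j : ℕ) (t : ℝ) :
    HasDerivAt (fun t : ℝ => (t * (1 - t)) ^ (j + 1) / (j + 1).factorial)
      ((t * (1 - t)) ^ j / j.factorial * (1 - 2 * t)) t := by
  have h1 : HasDerivAt (fun t : ℝ => t * (1 - t)) (1 - 2 * t) t := by
    refine HasDerivAt.congr_deriv ((hasDerivAt_id t).mul ((hasDerivAt_id t).const_sub 1)) ?_
    simp; ring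
  refine HasDerivAt.congr_deriv ((h1.pow (j + 1)).div_const ((j + 1).factorial : ℝ)) ?_
  rw [Nat.factorial_succ]
  push_cast
  have : (j.factorial : ℝ) ≠ 0 := by positivity
  have : (j : ℝ) + 1 ≠ 0 := by positivity
  field_simp

theorem hasDerivAt_exp_mul (c t : ℝ) :
    HasDerivAt (fun t : ℝ => Real.exp (c * t)) (c * Real.exp (c * t)) t := by
  refine HasDerivAt.congr_deriv ((hasDerivAt_id t).const_mul c).exp ?_
  simp; ring

theorem padeRem_one {c : ℝ} (hc : 0 < c) :
    padeRem c 1 = Real.exp c + 1 - 2 / c * (Real.exp c - 1) := by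
  have hint : ∫ t in (0 : ℝ)..1, ((t * (1 - t)) ^ 0 / (0 : ℕ).factorial * Real.exp (c * t)) * (-2)
      - c ^ 2 * ((t * (1 - t)) ^ 1 / (1 : ℕ).factorial * Real.exp (c * t)) = -Real.exp c - 1 := by
    rw [intervalIntegral.integral_eq_sub_of_hasDerivAt
      (f := fun t => ((1 - 2 * t) - c * ((t * (1 - t)) ^ 1 / (1 : ℕ).factorial)) * Real.exp (c * t))]
    · simp; ring
    · intro t _
      have h1 := hasDerivAt_pow_div_factorial 0 t
      have h2 := hasDerivAt_exp_mul c t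
      have h3 : HasDerivAt (fun t : ℝ => 1 - 2 * t) (-2) t := by
        simpa using ((hasDerivAt_id t).const_mul 2).const_sub 1
      refine HasDerivAt.congr_deriv ((h3.sub (h1.const_mul c)).mul h2) ?_
      simp; ring
    · exact Continuous.intervalIntegrable (by fun_prop) _ _
  rw [intervalIntegral.integral_sub (Continuous.intervalIntegrable (by fun_prop) _ _)
    (Continuous.intervalIntegrable (by fun_prop) _ _), intervalIntegral.integral_mul_const,
    intervalIntegral.integral_const_mul] at hint
  have h0 := padeRem_zero hc
  unfold padeRem at h0 ⊢
  have : c * (2 / c) = 2 := by field_simp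
  linear_combination (-1) * hint - (2 / c) * h0 + (∫ t in (0 : ℝ)..1,
    (t * (1 - t)) ^ 0 / (0 : ℕ).factorial * Real.exp (c * t)) * this

/-- Integrating by parts twice gives the recurrence of the continued fraction of `coth`. -/
theorem padeRem_rec {c : ℝ} (hc : 0 < c) (j : ℕ) :
    padeRem c j = (2 * j + 3) * (2 / c) * padeRem c (j + 1) + padeRem c (j + 2) := by
  have hint : ∫ t in (0 : ℝ)..1, ((t * (1 - t)) ^ j / j.factorial * Real.exp (c * t)
      - (4 * j + 6) * ((t * (1 - t)) ^ (j + 1) / (j + 1).factorial * Real.exp (c * t)))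
      - c ^ 2 * ((t * (1 - t)) ^ (j + 2) / (j + 2).factorial * Real.exp (c * t)) = 0 := by
    rw [intervalIntegral.integral_eq_sub_of_hasDerivAt
      (f := fun t => ((t * (1 - t)) ^ (j + 1) / (j + 1).factorial * (1 - 2 * t) -
        c * ((t * (1 - t)) ^ (j + 2) / (j + 2).factorial)) * Real.exp (c * t))]
    · simp
    · intro t _
      have h1 := hasDerivAt_pow_div_factorial j t
      have h1' := hasDerivAt_pow_div_factorial (j + 1) t
      have h2 := hasDerivAt_exp_mul c t
      have h3 : HasDerivAt (fun t : ℝ => 1 - 2 * t) (-2) t := by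
        simpa using ((hasDerivAt_id t).const_mul 2).const_sub 1
      refine HasDerivAt.congr_deriv (((h1.mul h3).sub (h1'.const_mul c)).mul h2) ?_
      have hf : (j.factorial : ℝ) ≠ 0 := by positivity
      have hj : (j : ℝ) + 1 ≠ 0 := by positivity
      have hj2 : (j : ℝ) + 1 + 1 ≠ 0 := by positivity
      simp only [Nat.factorial_succ, Pi.sub_apply, Pi.mul_apply]
      push_cast
      field_simp
      ring
    · exact Continuous.intervalIntegrable (by fun_prop) _ _
  rw [intervalIntegral.integral_sub (Continuous.intervalIntegrable (by fun_prop) _ _)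
    (Continuous.intervalIntegrable (by fun_prop) _ _),
    intervalIntegral.integral_sub (Continuous.intervalIntegrable (by fun_prop) _ _)
    (Continuous.intervalIntegrable (by fun_prop) _ _), intervalIntegral.integral_const_mul,
    intervalIntegral.integral_const_mul] at hint
  unfold padeRem
  have : c * (2 / c) = 2 := by field_simp
  linear_combination c ^ (j + 1) * hint - (2 * j + 3) * c ^ (j + 1) * (∫ t in (0 : ℝ)..1,
    (t * (1 - t)) ^ (j + 1) / (j + 1).factorial * Real.exp (c * t)) * this

/-- A sequence of positive remainders witnessing `coth (1 / k) = [k; 3 k, 5 k, …]`, expressed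
through `e^{2/k}`. -/
theorem exists_exp_remainders {k : ℕ} (hk : 1 ≤ k) : ∃ R : ℕ → ℝ, (∀ j, 0 < R j) ∧
    R 0 = Real.exp (2 / k) - 1 ∧
    R 1 = Real.exp (2 / k) + 1 - k * (Real.exp (2 / k) - 1) ∧
    ∀ j : ℕ, R j = (2 * j + 3) * k * R (j + 1) + R (j + 2) := by
  have hc : (0 : ℝ) < 2 / k := by positivity
  have h2 : (2 : ℝ) / (2 / k) = k := by field_simp
  refine ⟨padeRem (2 / k), padeRem_pos hc, padeRem_zero hc, ?_, fun j => ?_⟩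
  · rw [padeRem_one hc, h2]
  · rw [padeRem_rec hc, h2]

/-! ### The continued fraction of `e^{2/k}` -/

/-- The partial quotients `1, m - 1, 1, 1, 3 m - 1, 1, 1, 5 m - 1, 1, …` of `e^{1/m}`. For `m = 1`
the term with index `1` is `0`; this is what makes the sequence purely periodic modulo `n`, unlike
`2, 1, 2, 1, 1, 4, 1, …`. -/
def expQuotEven (m : ℕ) (i : ℕ) : ℤ :=
  if i % 3 = 1 then (2 * (i / 3 : ℕ) + 1) * m - 1 else 1

/-- The partial quotients `1, (k-1)/2, 6 k, (5k-1)/2, 1, 1, (7k-1)/2, 18 k, (11k-1)/2, 1, …` of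
`e^{2/k}` for odd `k = 2 l + 1`. -/
def expQuotOdd (l : ℕ) (i : ℕ) : ℤ :=
  if i % 5 = 1 then (6 * (i / 5 : ℕ) + 1) * l + 3 * (i / 5 : ℕ)
  else if i % 5 = 2 then (12 * (i / 5 : ℕ) + 6) * (2 * l + 1)
  else if i % 5 = 3 then (6 * (i / 5 : ℕ) + 5) * l + 3 * (i / 5 : ℕ) + 2
  else 1

section Even

variable (m j : ℕ)

theorem expQuotEven_zero : expQuotEven m (3 * j) = 1 := by
  simp [expQuotEven]

theorem expQuotEven_one : expQuotEven m (3 * j + 1) = (2 * j + 1) * m - 1 := by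
  simp [expQuotEven, show (3 * j + 1) / 3 = j by omega, Nat.add_mod]

theorem expQuotEven_two : expQuotEven m (3 * j + 2) = 1 := by
  simp [expQuotEven, Nat.add_mod]

theorem expQuotEven_periodic {n : ℕ} (hn : 2 ≤ n) : CompletelyPeriodicMod n (expQuotEven m) := by
  refine ⟨3 * n, by omega, fun i => ?_⟩
  obtain ⟨j, rfl | rfl | rfl⟩ : ∃ j, i = 3 * j ∨ i = 3 * j + 1 ∨ i = 3 * j + 2 :=
    ⟨i / 3, by omega⟩
  · rw [← mul_add, expQuotEven_zero, expQuotEven_zero]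
  · rw [show 3 * j + 1 + 3 * n = 3 * (j + n) + 1 by ring, expQuotEven_one, expQuotEven_one,
      Int.modEq_iff_dvd]
    exact ⟨-(2 * m), by push_cast; ring⟩
  · rw [show 3 * j + 2 + 3 * n = 3 * (j + n) + 2 by ring, expQuotEven_two, expQuotEven_two]

theorem expQuotEven_nonneg {m : ℕ} (hm : 1 ≤ m) (i : ℕ) : 0 ≤ expQuotEven m i := by
  unfold expQuotEven
  split_ifs
  · have : (1 : ℤ) ≤ (2 * (i / 3 : ℕ) + 1) * m := one_le_mul_of_one_le_of_one_le (by omega)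
      (by omega)
    omega
  · exact zero_le_one

theorem expQuotEven_pattern {m : ℕ} (hm : 1 ≤ m) : LargeOrPairOfOnes (expQuotEven m) := by
  intro A
  have hge : ∀ j : ℕ, A.toNat ≤ j → A ≤ expQuotEven m (3 * j + 1) := by
    intro j hj
    rw [expQuotEven_one]
    have : (2 * (j : ℤ) + 1) * 1 ≤ (2 * j + 1) * m :=
      mul_le_mul_of_nonneg_left (by exact_mod_cast hm) (by omega)
    omega
  refine eventually_atTop.2 ⟨3 * A.toNat + 3, fun i hi => ?_⟩
  obtain ⟨j, h | h | h⟩ : ∃ j, i = 3 * j + 1 ∨ i = 3 * j + 2 ∨ i = 3 * j :=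
    ⟨i / 3, by omega⟩ <;> subst h
  · right; right
    exact ⟨expQuotEven_two m j, expQuotEven_zero m (j + 1), hge j (by omega),
      hge (j + 1) (by omega)⟩
  · left
    exact hge (j + 1) (by omega)
  · right; left
    exact ⟨expQuotEven_two m j, expQuotEven_zero m (j + 1), hge j (by omega),
      hge (j + 1) (by omega)⟩

end Even

/-- With `R` as in `exists_exp_remainders`, the remainders of the convergents are, up to the sign
`(-1)^j`, `R_j`, `-(R_j + R_{j+1}) / 2` and `(R_j - R_{j+1}) / 2`. -/
theorem expQuotEven_alternating {m : ℕ} (hm : 1 ≤ m) (i : ℕ) (hi : 2 ≤ i) :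
    convErr (expQuotEven m) (Real.exp (2 / (2 * m : ℕ))) i *
      convErr (expQuotEven m) (Real.exp (2 / (2 * m : ℕ))) (i + 1) < 0 := by
  obtain ⟨R, hR, hR0, hR1, hrec⟩ := exists_exp_remainders (k := 2 * m) (by omega)
  set θ := Real.exp (2 / (2 * m : ℕ))
  have hm' : (1 : ℝ) ≤ m := by exact_mod_cast hm
  push_cast at hR1 hrec
  set D := convErr (expQuotEven m) θ
  have hDrec : ∀ i, D (i + 2) = expQuotEven m i * D (i + 1) + D i := convErr_add_two _ _
  have hdec : ∀ j, R (j + 1) < R j := by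
    intro j
    rw [hrec j]
    have h1 := hR (j + 1)
    have h2 := hR (j + 2)
    have : 1 ≤ (2 * (j : ℝ) + 3) * (2 * m) := by
      have : (0 : ℝ) ≤ j := by positivity
      nlinarith
    nlinarith
  have hsol : ∀ j, D (3 * j + 2) = (-1) ^ j * R j ∧
      D (3 * j + 3) = -((-1) ^ j * (R j + R (j + 1)) / 2) ∧
      D (3 * j + 4) = (-1) ^ j * (R j - R (j + 1)) / 2 := by
    intro j
    induction j with
    | zero =>
      have h2 : D 2 = R 0 := by
        rw [hDrec 0, show expQuotEven m 0 = 1 from expQuotEven_zero m 0, hR0]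
        simp [D, convErr, convSeq]; ring
      have h3 : D 3 = -((R 0 + R 1) / 2) := by
        rw [hDrec 1, show expQuotEven m 1 = _ from expQuotEven_one m 0, h2,
          show D 1 = -1 by simp [D, convErr, convSeq], hR0, hR1]
        push_cast; ring
      refine ⟨by simpa using h2, by simpa using h3, ?_⟩
      rw [hDrec (3 * 0 + 2), expQuotEven_two, show D (3 * 0 + 2 + 1) = _ from h3,
        show D (3 * 0 + 2) = _ from h2]
      push_cast; ring
    | succ j ih =>
      obtain ⟨i2, i3, i4⟩ := ih
      have h5 : D (3 * (j + 1) + 2) = (-1) ^ (j + 1) * R (j + 1) := by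
        rw [hDrec (3 * (j + 1)), expQuotEven_zero, show 3 * (j + 1) + 1 = 3 * j + 4 by ring,
          show 3 * (j + 1) = 3 * j + 3 by ring, i4, i3]
        push_cast; ring
      have h6 : D (3 * (j + 1) + 3) = -((-1) ^ (j + 1) * (R (j + 1) + R (j + 1 + 1)) / 2) := by
        rw [show 3 * (j + 1) + 3 = 3 * (j + 1) + 1 + 2 by ring, hDrec, expQuotEven_one, h5,
          show 3 * (j + 1) + 1 = 3 * j + 4 by ring, i4, hrec j]
        push_cast; ring
      refine ⟨h5, h6, ?_⟩
      rw [show 3 * (j + 1) + 4 = 3 * (j + 1) + 2 + 2 by ring, hDrec, expQuotEven_two, h6, h5]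
      push_cast; ring
  have hsign : ∀ j : ℕ, ((-1 : ℝ) ^ j) * (-1) ^ j = 1 := fun j => by rw [← mul_pow]; simp
  obtain ⟨j, h | h | h⟩ : ∃ j, i = 3 * j + 2 ∨ i = 3 * j + 3 ∨ i = 3 * j + 4 :=
    ⟨(i - 2) / 3, by omega⟩ <;> subst h
  all_goals
    have a1 := hR j
    have a2 := hR (j + 1)
    have a3 := sub_pos.2 (hdec j)
    obtain ⟨i2, i3, i4⟩ := hsol j
  · rw [i2, i3]
    have := mul_pos a1 (add_pos a1 a2)
    linear_combination (1 / 2 : ℝ) * this - R j * (R j + R (j + 1)) / 2 * hsign j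
  · rw [i3, i4]
    have := mul_pos a3 (add_pos a1 a2)
    linear_combination (1 / 4 : ℝ) * this - (R j - R (j + 1)) * (R j + R (j + 1)) / 4 * hsign j
  · rw [i4, show 3 * j + 4 + 1 = 3 * (j + 1) + 2 by ring, (hsol (j + 1)).1]
    have := mul_pos a3 a2
    linear_combination (1 / 2 : ℝ) * this - (R j - R (j + 1)) * R (j + 1) / 2 * hsign j

section Odd

variable (l j : ℕ)

theorem expQuotOdd_zero : expQuotOdd l (5 * j) = 1 := by
  simp [expQuotOdd]

theorem expQuotOdd_one : expQuotOdd l (5 * j + 1) = (6 * j + 1) * l + 3 * j := by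
  simp [expQuotOdd, show (5 * j + 1) / 5 = j by omega, Nat.add_mod]

theorem expQuotOdd_two : expQuotOdd l (5 * j + 2) = (12 * j + 6) * (2 * l + 1) := by
  simp [expQuotOdd, show (5 * j + 2) / 5 = j by omega, Nat.add_mod]

theorem expQuotOdd_three : expQuotOdd l (5 * j + 3) = (6 * j + 5) * l + 3 * j + 2 := by
  simp [expQuotOdd, show (5 * j + 3) / 5 = j by omega, Nat.add_mod]

theorem expQuotOdd_four : expQuotOdd l (5 * j + 4) = 1 := by
  simp [expQuotOdd, Nat.add_mod]

theorem expQuotOdd_periodic {n : ℕ} (hn : 2 ≤ n) : CompletelyPeriodicMod n (expQuotOdd l) := by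
  refine ⟨5 * n, by omega, fun i => ?_⟩
  obtain ⟨j, rfl | rfl | rfl | rfl | rfl⟩ : ∃ j, i = 5 * j ∨ i = 5 * j + 1 ∨ i = 5 * j + 2 ∨
    i = 5 * j + 3 ∨ i = 5 * j + 4 := ⟨i / 5, by omega⟩
  · rw [← mul_add, expQuotOdd_zero, expQuotOdd_zero]
  · rw [show 5 * j + 1 + 5 * n = 5 * (j + n) + 1 by ring, expQuotOdd_one, expQuotOdd_one,
      Int.modEq_iff_dvd]
    exact ⟨-(6 * l + 3), by push_cast; ring⟩
  · rw [show 5 * j + 2 + 5 * n = 5 * (j + n) + 2 by ring, expQuotOdd_two, expQuotOdd_two,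
      Int.modEq_iff_dvd]
    exact ⟨-(12 * (2 * l + 1)), by push_cast; ring⟩
  · rw [show 5 * j + 3 + 5 * n = 5 * (j + n) + 3 by ring, expQuotOdd_three, expQuotOdd_three,
      Int.modEq_iff_dvd]
    exact ⟨-(6 * l + 3), by push_cast; ring⟩
  · rw [show 5 * j + 4 + 5 * n = 5 * (j + n) + 4 by ring, expQuotOdd_four, expQuotOdd_four]

theorem expQuotOdd_nonneg (i : ℕ) : 0 ≤ expQuotOdd l i := by
  unfold expQuotOdd
  split_ifs <;> positivity

theorem expQuotOdd_pattern : LargeOrPairOfOnes (expQuotOdd l) := by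
  intro A
  have hge : ∀ j : ℕ, A.toNat ≤ j → A ≤ expQuotOdd l (5 * j + 1) ∧
      A ≤ expQuotOdd l (5 * j + 2) ∧ A ≤ expQuotOdd l (5 * j + 3) := by
    intro j hj
    rw [expQuotOdd_one, expQuotOdd_two, expQuotOdd_three]
    have h1 : 0 ≤ (6 * (j : ℤ) + 1) * l := by positivity
    have h2 : 0 ≤ (12 * (j : ℤ) + 6) * l := by positivity
    have h3 : 0 ≤ (6 * (j : ℤ) + 5) * l := by positivity
    refine ⟨by omega, ?_, by omega⟩
    rw [show (12 * (j : ℤ) + 6) * (2 * l + 1) = 2 * ((12 * j + 6) * l) + (12 * j + 6) by ring]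
    omega
  refine eventually_atTop.2 ⟨5 * A.toNat + 5, fun i hi => ?_⟩
  obtain ⟨j, h | h | h | h | h⟩ : ∃ j, i = 5 * j ∨ i = 5 * j + 1 ∨ i = 5 * j + 2 ∨
    i = 5 * j + 3 ∨ i = 5 * j + 4 := ⟨i / 5, by omega⟩ <;> subst h
  · left
    exact (hge j (by omega)).2.1
  · left
    exact (hge j (by omega)).2.2
  · right; left
    exact ⟨expQuotOdd_four l j, expQuotOdd_zero l (j + 1), (hge j (by omega)).2.2,
      (hge (j + 1) (by omega)).1⟩
  · right; right
    exact ⟨expQuotOdd_four l j, expQuotOdd_zero l (j + 1), (hge j (by omega)).2.2,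
      (hge (j + 1) (by omega)).1⟩
  · left
    exact (hge (j + 1) (by omega)).1

end Odd

/-- With `R` as in `exists_exp_remainders`, the remainders of the convergents are, up to the sign
`(-1)^j`, `R_{3j}`, `-R_{3j+1} / 2`, `R_{3j+2}`, `-(R_{3j+2} + R_{3j+3}) / 2` and
`(R_{3j+2} - R_{3j+3}) / 2`. -/
theorem expQuotOdd_alternating (l : ℕ) (i : ℕ) (hi : 2 ≤ i) :
    convErr (expQuotOdd l) (Real.exp (2 / (2 * l + 1 : ℕ))) i *
      convErr (expQuotOdd l) (Real.exp (2 / (2 * l + 1 : ℕ))) (i + 1) < 0 := by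
  obtain ⟨R, hR, hR0, hR1, hrec⟩ := exists_exp_remainders (k := 2 * l + 1) (by omega)
  set θ := Real.exp (2 / (2 * l + 1 : ℕ))
  push_cast at hR1 hrec
  set D := convErr (expQuotOdd l) θ
  have hDrec : ∀ i, D (i + 2) = expQuotOdd l i * D (i + 1) + D i := convErr_add_two _ _
  have hdec : ∀ j, R (j + 1) < R j := by
    intro j
    rw [hrec j]
    have h1 := hR (j + 1)
    have h2 := hR (j + 2)
    have : 1 ≤ (2 * (j : ℝ) + 3) * (2 * l + 1) := by
      have : (0 : ℝ) ≤ j := by positivity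
      have : (0 : ℝ) ≤ l := by positivity
      nlinarith
    nlinarith
  -- Each block of five remainders is determined by the last remainder of the previous block and
  -- the first one of its own.
  have hblock : ∀ j, D (5 * j + 2) = (-1) ^ j * R (3 * j) →
      D (5 * j + 3) = -((-1) ^ j * R (3 * j + 1) / 2) →
      D (5 * j + 4) = (-1) ^ j * R (3 * j + 2) ∧
      D (5 * j + 5) = -((-1) ^ j * (R (3 * j + 2) + R (3 * j + 3)) / 2) ∧
      D (5 * j + 6) = (-1) ^ j * (R (3 * j + 2) - R (3 * j + 3)) / 2 ∧
      D (5 * (j + 1) + 2) = (-1) ^ (j + 1) * R (3 * (j + 1)) := by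
    intro j h2 h3
    have h4 : D (5 * j + 4) = (-1) ^ j * R (3 * j + 2) := by
      rw [hDrec (5 * j + 2), expQuotOdd_two, h2, show 5 * j + 2 + 1 = 5 * j + 3 by ring, h3,
        hrec (3 * j)]
      push_cast; ring
    have h5 : D (5 * j + 5) = -((-1) ^ j * (R (3 * j + 2) + R (3 * j + 3)) / 2) := by
      rw [hDrec (5 * j + 3), expQuotOdd_three, h3, show 5 * j + 3 + 1 = 5 * j + 4 by ring, h4,
        hrec (3 * j + 1)]
      push_cast; ring
    have h6 : D (5 * j + 6) = (-1) ^ j * (R (3 * j + 2) - R (3 * j + 3)) / 2 := by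
      rw [hDrec (5 * j + 4), expQuotOdd_four, h4, show 5 * j + 4 + 1 = 5 * j + 5 by ring, h5]
      push_cast; ring
    refine ⟨h4, h5, h6, ?_⟩
    rw [hDrec (5 * (j + 1)), expQuotOdd_zero, show 5 * (j + 1) + 1 = 5 * j + 6 by ring, h6,
      show 5 * (j + 1) = 5 * j + 5 by ring, h5, show 3 * (j + 1) = 3 * j + 3 by ring]
    push_cast; ring
  have hsol : ∀ j, D (5 * j + 2) = (-1) ^ j * R (3 * j) ∧
      D (5 * j + 3) = -((-1) ^ j * R (3 * j + 1) / 2) := by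
    intro j
    induction j with
    | zero =>
      have h2 : D 2 = R 0 := by
        rw [hDrec 0, show expQuotOdd l 0 = 1 from expQuotOdd_zero l 0, hR0]
        simp [D, convErr, convSeq]; ring
      have h3 : D 3 = -(R 1 / 2) := by
        rw [hDrec 1, show expQuotOdd l 1 = _ from expQuotOdd_one l 0, h2,
          show D 1 = -1 by simp [D, convErr, convSeq], hR0, hR1]
        push_cast; ring
      exact ⟨by simpa using h2, by simpa using h3⟩
    | succ j ih =>
      obtain ⟨h4, h5, h6, h7⟩ := hblock j ih.1 ih.2
      refine ⟨h7, ?_⟩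
      rw [hDrec (5 * (j + 1) + 1), expQuotOdd_one, h7, show 5 * (j + 1) + 1 = 5 * j + 6 by ring, h6,
        show 3 * (j + 1) = 3 * j + 2 + 1 by ring, hrec (3 * j + 2)]
      push_cast; ring
  have hsign : ∀ j : ℕ, ((-1 : ℝ) ^ j) * (-1) ^ j = 1 := fun j => by rw [← mul_pow]; simp
  obtain ⟨j, h | h | h | h | h⟩ : ∃ j, i = 5 * j + 2 ∨ i = 5 * j + 3 ∨ i = 5 * j + 4 ∨
    i = 5 * j + 5 ∨ i = 5 * j + 6 := ⟨(i - 2) / 5, by omega⟩ <;> subst h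
  all_goals
    have a0 := hR (3 * j)
    have a1 := hR (3 * j + 1)
    have a2 := hR (3 * j + 2)
    have a3 : 0 < R (3 * j + 3) := hR (3 * j + 3)
    have a4 : 0 < R (3 * j + 2) - R (3 * j + 3) := sub_pos.2 (hdec (3 * j + 2))
    obtain ⟨i2, i3⟩ := hsol j
    obtain ⟨i4, i5, i6, i7⟩ := hblock j i2 i3
  · rw [i2, i3]
    have := mul_pos a0 a1
    linear_combination (1 / 2 : ℝ) * this - R (3 * j) * R (3 * j + 1) / 2 * hsign j
  · rw [i3, i4]
    have := mul_pos a1 a2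
    linear_combination (1 / 2 : ℝ) * this - R (3 * j + 1) * R (3 * j + 2) / 2 * hsign j
  · rw [i4, i5]
    have := mul_pos a2 (add_pos a2 a3)
    linear_combination (1 / 2 : ℝ) * this -
      R (3 * j + 2) * (R (3 * j + 2) + R (3 * j + 3)) / 2 * hsign j
  · rw [i5, i6]
    have := mul_pos a4 (add_pos a2 a3)
    linear_combination (1 / 4 : ℝ) * this -
      (R (3 * j + 2) - R (3 * j + 3)) * (R (3 * j + 2) + R (3 * j + 3)) / 4 * hsign j
  · rw [i6, show 5 * j + 6 + 1 = 5 * (j + 1) + 2 by ring, i7, show 3 * (j + 1) = 3 * j + 3 by ring]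
    have := mul_pos a4 a3
    linear_combination (1 / 2 : ℝ) * this -
      (R (3 * j + 2) - R (3 * j + 3)) * R (3 * j + 3) / 2 * hsign j

theorem theorem7 :
    (∀ (θ : ℝ) (b a c : ℕ → ℤ) (len : ℕ → ℕ) (n : ℕ),
      Irrational θ →
      HasPartialQuotients θ b →
      HasBlockForm b a c len →
      2 ≤ n →
      CompletelyPeriodicMod n b →
      (∀ i : ℕ, 1 ≤ i → len i = 0 ∨ len i = 2) →
      ∀ φ : ℝ, φ = 1 / (n : ℝ) ∨ φ = -θ / (n : ℝ) →
        (n : ℝ≥0∞) ^ 2 * inhomApproxConst θ φ = 0 ∨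
          (n : ℝ≥0∞) ^ 2 * inhomApproxConst θ φ = 1 / 2) ∧
    (∀ k n : ℕ, 2 ≤ k → 2 ≤ n →
      ∀ φ : ℝ, φ = 1 / (n : ℝ) ∨ φ = -Real.exp (2 / (k : ℝ)) / (n : ℝ) →
        (n : ℝ≥0∞) ^ 2 * inhomApproxConst (Real.exp (2 / (k : ℝ))) φ = 0 ∨
          (n : ℝ≥0∞) ^ 2 * inhomApproxConst (Real.exp (2 / (k : ℝ))) φ = 1 / 2) := by
  refine ⟨fun θ b a c len n hθ hpq hform hn hper hlen φ hφ => ?_, fun k n hk hn φ hφ => ?_⟩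
  · exact sq_mul_inhomApproxConst_eq_zero_or_half hn
      (fun i hi => zero_le_one.trans (hpq.one_le hθ hi))
      (hform.largeOrPairOfOnes (fun i hi => hpq.one_le hθ hi) hlen)
      (eventually_atTop.2 ⟨1, fun i hi => hpq.convErr_mul_neg hθ hi⟩) hper hφ
  · obtain ⟨m, rfl | rfl⟩ := Nat.even_or_odd' k
    · exact sq_mul_inhomApproxConst_eq_zero_or_half hn
        (fun i _ => expQuotEven_nonneg (by omega) i) (expQuotEven_pattern (by omega))
        (eventually_atTop.2 ⟨2, expQuotEven_alternating (by omega)⟩)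
        (expQuotEven_periodic m hn) hφ
    · exact sq_mul_inhomApproxConst_eq_zero_or_half hn
        (fun i _ => expQuotOdd_nonneg m i) (expQuotOdd_pattern m)
        (eventually_atTop.2 ⟨2, expQuotOdd_alternating m⟩)
        (expQuotOdd_periodic m hn) hφ
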